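/- All graphs are finite and simple; $\chi(G)$ and $\omega(G)$ denote the chromatic number and the clique number of $G$. Write $P_3\cup P_2$ for the disjoint union of the paths on $3$ and on $2$ vertices, and $2K_1+K_p$ for the join of two isolated vertices with the complete graph on $p$ vertices (that is, $K_{p+2}$ minus an edge). A graph is $\{H_1,H_2\}$-free if none of its induced subgraphs is isomorphic to $H_1$ or $H_2$. Let $p\ge 2$ be an integer, let $G$ be a $\{P_3\cup P_2,\,2K_1+K_p\}$-free graph, and put $\omega=\omega(G)$. Then: 1. if $3\le\omega\le p+1$, then $\chi(G)\le \omega+\sum_{j=2}^{p+1}(j-1)(p-j+3)$; 2. if $\omega=p+2+k$ for an integer $k$ with $0\le k\le 2p-5$, then $\chi(G)\le \omega+2p-1+\sum_{j=3}^{p-\lfloor k/2\rfloor}(j-1)(p-j+3)$; 3. if $\omega=3p-2$, then $\chi(G)\le\omega+2p-1$; 4. if $\omega\ge 3p-1$, then $\chi(G)=\omega$. -/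

import Mathlib

namespace SimpleGraph

/-- The join of two vertex-disjoint graphs: their disjoint union together with all edges
between the two vertex sets. -/
def graphJoin {V W : Type*} (G : SimpleGraph V) (H : SimpleGraph W) : SimpleGraph (V ⊕ W) :=
  (G ⊕g H) ⊔ completeBipartiteGraph V W

/-- `P₃ ∪ P₂`: the disjoint union of the paths on three and on two vertices. -/
def P3UnionP2 : SimpleGraph (Fin 3 ⊕ Fin 2) :=
  pathGraph 3 ⊕g pathGraph 2

/-- `2K₁ + K_p`: the join of two isolated vertices with the complete graph on `p` vertices. -/
def twoK1JoinK (p : ℕ) : SimpleGraph (Fin 2 ⊕ Fin p) :=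
  graphJoin (⊥ : SimpleGraph (Fin 2)) (⊤ : SimpleGraph (Fin p))

/-- `G` is `H`-free: no induced subgraph of `G` is isomorphic to `H`. -/
def IndFree {V W : Type*} (G : SimpleGraph V) (H : SimpleGraph W) : Prop :=
  ¬ H.IsIndContained G

end SimpleGraph

/-!
The bounds come from colouring around a maximum clique `A`, with `ω` vertices. Since `G` is
`(2K₁ + K_p)`-free, a vertex outside a clique which is not complete to it has fewer than `p`
neighbours in it; applied to `A`, every other vertex has fewer than `p` neighbours in `A`. Since `G`
is `(P₃ ∪ P₂)`-free, the common non-neighbours of an edge induce no `P₃`, that is, a disjoint union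
of cliques, and an induced `P₃` leaves at most one vertex of any clique without neighbours on it.

A set `X` outside `A` that induces a disjoint union of cliques costs no new colours: by Hall's
theorem `A ∪ X` is `ω`-colourable (`IsP3FreeOn.colorable_induce_union_maxClique`). When
`ω ≥ 3 p - 1`, three vertices outside `A` leave two vertices of `A` uncovered, so all of `G - A` is
such a set.

For `ω = p + 2 + k`, order `A` as `v 0, v 1, …` and put `M = p - ⌊k / 2⌋`. The same count shows that
the vertices with at most one non-neighbour among `v 0, …, v (M - 1)` induce no `P₃`. They are
coloured with the colours of `A`, together with the complete components of `G - A`. The other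
vertices are sorted into classes by their first two non-neighbours `v i`, `v j`; each class is a
disjoint union of cliques, and two facts bound the number of colours.

* A clique of `2 p` or more vertices in a class lies in a complete component of `G - A`
  (`subset_cliqueComponents_of_two_mul_le`), so the class of `v 0`, `v 1` needs `2 p - 1` colours.
* If some clique in the class of `v i`, `v j` has more than `p + 2 - j` vertices, then no other
  class has second non-neighbour `v j` (`missClass_eq_empty_of_large_clique`). So the `j` classes
  with second non-neighbour `v j` together need at most
  `max (2 p - 1) (j (p + 2 - j)) = j (p + 2 - j)` colours when `2 ≤ j < p`.

For `ω ≤ p + 1` the clique number alone bounds the cliques of each class, and a vertex with a single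
non-neighbour in `A` takes its colour.
-/

namespace SimpleGraph

section

open scoped Classical
open Finset

variable {V : Type*} {G : SimpleGraph V}

/-! ### Forbidden induced subgraphs -/

/-- A path `a - b - c` with `a`, `c` non-adjacent and an edge `d - e` with no edges to the path
form an induced `P₃ ∪ P₂`. -/
theorem IndFree.false_of_path_edge (h : G.IndFree P3UnionP2) {a b c d e : V}
    (hab : G.Adj a b) (hbc : G.Adj b c) (hne : a ≠ c) (hac : ¬ G.Adj a c) (hde : G.Adj d e)
    (had : ¬ G.Adj a d) (hae : ¬ G.Adj a e) (hbd : ¬ G.Adj b d) (hbe : ¬ G.Adj b e)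
    (hcd : ¬ G.Adj c d) (hce : ¬ G.Adj c e) : False := by
  have hda : ¬ G.Adj d a := fun h => had h.symm
  have hea : ¬ G.Adj e a := fun h => hae h.symm
  have hdb : ¬ G.Adj d b := fun h => hbd h.symm
  have heb : ¬ G.Adj e b := fun h => hbe h.symm
  have hdc : ¬ G.Adj d c := fun h => hcd h.symm
  have hec : ¬ G.Adj e c := fun h => hce h.symm
  have hca : ¬ G.Adj c a := fun h => hac h.symm
  have n1 : a ≠ d := by rintro rfl; exact hbd hab.symm
  have n2 : a ≠ e := by rintro rfl; exact hbe hab.symm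
  have n3 : b ≠ d := by rintro rfl; exact had hab
  have n4 : b ≠ e := by rintro rfl; exact hae hab
  have n5 : c ≠ d := by rintro rfl; exact hbd hbc
  have n6 : c ≠ e := by rintro rfl; exact hbe hbc
  refine h ⟨⟨⟨Sum.elim ![a, b, c] ![d, e], ?_⟩, ?_⟩⟩
  · rintro (i | i) (j | j) hij <;> fin_cases i <;> fin_cases j <;>
      simp_all [hab.ne, hbc.ne, hde.ne, hab.ne', hbc.ne', hde.ne', Ne.symm]
  · intro i j
    change G.Adj (Sum.elim _ _ i) (Sum.elim _ _ j) ↔ _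
    rcases i with i | i <;> rcases j with j | j <;> fin_cases i <;> fin_cases j <;>
      simp [P3UnionP2, pathGraph_adj, *, hab.symm, hbc.symm, hde.symm]

/-- Two distinct non-adjacent vertices have fewer than `p` common neighbours in any clique. -/
theorem IndFree.false_of_common_clique {p : ℕ} (h : G.IndFree (twoK1JoinK p)) {u v : V}
    (hne : u ≠ v) (huv : ¬ G.Adj u v) {s : Finset V} (hs : G.IsClique s) (hp : p ≤ #s)
    (hu : ∀ x ∈ s, G.Adj u x) (hv : ∀ x ∈ s, G.Adj v x) : False := by
  obtain ⟨t, hts, htp⟩ := exists_subset_card_eq hp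
  have f : Fin p ≃ t := (t.equivFinOfCardEq htp).symm
  have hm : ∀ i, (f i : V) ∈ s := fun i => hts (f i).2
  have hvu : ¬ G.Adj v u := fun h => huv h.symm
  have hinj : ∀ i j, (f i : V) = f j ↔ i = j := fun i j => by
    rw [Subtype.coe_inj, f.injective.eq_iff]
  have hadj : ∀ i j, G.Adj (f i : V) (f j) ↔ i ≠ j := fun i j =>
    ⟨fun h e => by subst e; exact G.irrefl h,
      fun h => hs (hm i) (hm j) (fun e => h ((hinj i j).1 e))⟩
  refine h ⟨⟨⟨Sum.elim ![u, v] (fun i => (f i : V)), ?_⟩, ?_⟩⟩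
  · rintro (i | i) (j | j) hij
    · fin_cases i <;> fin_cases j <;> simp_all [Ne.symm]
    · fin_cases i
      · exact absurd hij (hu _ (hm j)).ne
      · exact absurd hij (hv _ (hm j)).ne
    · fin_cases j
      · exact absurd hij (hu _ (hm i)).ne'
      · exact absurd hij (hv _ (hm i)).ne'
    · exact congrArg _ ((hinj i j).1 hij)
  · intro i j
    change G.Adj (Sum.elim _ _ i) (Sum.elim _ _ j) ↔ _
    rcases i with i | i <;> rcases j with j | j
    · fin_cases i <;> fin_cases j <;> simp [twoK1JoinK, graphJoin, huv, hvu]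
    · fin_cases i <;> simp [twoK1JoinK, graphJoin, hu _ (hm j), hv _ (hm j)]
    · fin_cases j <;> simp [twoK1JoinK, graphJoin, (hu _ (hm i)).symm, (hv _ (hm i)).symm]
    · simp [twoK1JoinK, graphJoin, hadj]

/-- A vertex that is not complete to a clique has fewer than `p` neighbours in it. -/
theorem IndFree.card_filter_adj_lt {p : ℕ} (h : G.IndFree (twoK1JoinK p)) {Q : Finset V}
    (hQ : G.IsClique Q) {z q : V} (hq : q ∈ Q) (hne : z ≠ q) (hzq : ¬ G.Adj z q) :
    #{x ∈ Q | G.Adj z x} < p := by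
  by_contra! hp
  refine h.false_of_common_clique hne hzq (hQ.subset (filter_subset _ _)) hp (by simp) ?_
  intro x hx
  simp only [mem_filter] at hx
  exact hQ hq hx.1 (by rintro rfl; exact hzq hx.2)

/-! ### Colouring graphs without induced paths on three vertices -/

/-- The vertices of `X` induce no path on three vertices; equivalently, they induce a disjoint
union of complete graphs. -/
def IsP3FreeOn (G : SimpleGraph V) (X : Set V) : Prop :=
  ∀ ⦃x⦄, x ∈ X → ∀ ⦃y⦄, y ∈ X → ∀ ⦃z⦄, z ∈ X → G.Adj x y → G.Adj y z → x ≠ z → G.Adj x z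

theorem IsP3FreeOn.mono {X Y : Set V} (h : G.IsP3FreeOn Y) (hXY : X ⊆ Y) : G.IsP3FreeOn X :=
  fun _ hx _ hy _ hz => h (hXY hx) (hXY hy) (hXY hz)

theorem colorable_induce_of_map {α : Type*} {s : Set V} (T : Finset α) (c : V → α)
    (hT : ∀ x ∈ s, c x ∈ T) (hc : ∀ x ∈ s, ∀ y ∈ s, G.Adj x y → c x ≠ c y) :
    (G.induce s).Colorable #T := by
  have C : (G.induce s).Coloring T := Coloring.mk (fun x => ⟨c x, hT x x.2⟩) (by
    intro x y hxy hcon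
    exact hc x x.2 y y.2 hxy (congrArg Subtype.val hcon))
  simpa using C.colorable

theorem Colorable.induce_mono {s t : Set V} {n : ℕ} (h : (G.induce t).Colorable n) (hst : s ⊆ t) :
    (G.induce s).Colorable n :=
  h.of_hom (G.induceHomOfLE hst).toHom

theorem Colorable.of_induce {s : Set V} {n : ℕ} (h : (G.induce s).Colorable n)
    (hs : ∀ x, x ∈ s) : G.Colorable n :=
  h.of_hom ⟨fun x => ⟨x, hs x⟩, fun hxy => hxy⟩

theorem Colorable.induce_union {s t : Set V} {m n : ℕ} (hs : (G.induce s).Colorable m)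
    (ht : (G.induce t).Colorable n) : (G.induce (s ∪ t)).Colorable (m + n) := by
  obtain ⟨cs⟩ := hs
  obtain ⟨ct⟩ := ht
  have C : (G.induce (s ∪ t)).Coloring (Fin m ⊕ Fin n) := Coloring.mk
    (fun x => if h : (x : V) ∈ s then Sum.inl (cs ⟨x, h⟩)
      else Sum.inr (ct ⟨x, x.2.resolve_left h⟩)) (by
    rintro ⟨x, hx⟩ ⟨y, hy⟩ hxy
    by_cases h1 : x ∈ s <;> by_cases h2 : y ∈ s <;> simp only [h1, h2, dite_true, dite_false]
    · exact fun h => cs.valid (v := ⟨x, h1⟩) (w := ⟨y, h2⟩) hxy (Sum.inl_injective h)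
    · simp
    · simp
    · exact fun h => ct.valid (v := ⟨x, hx.resolve_left h1⟩) (w := ⟨y, hy.resolve_left h2⟩) hxy
        (Sum.inr_injective h))
  simpa using C.colorable

theorem Colorable.induce_biUnion {ι : Type*} (T : Finset ι) (s : ι → Set V) (n : ι → ℕ)
    (h : ∀ i ∈ T, (G.induce (s i)).Colorable (n i)) :
    (G.induce {x | ∃ i ∈ T, x ∈ s i}).Colorable (∑ i ∈ T, n i) := by
  induction T using Finset.induction_on with
  | empty =>
    have : IsEmpty ({x | ∃ i ∈ (∅ : Finset ι), x ∈ s i} : Set V) := by simp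
    exact Colorable.of_isEmpty _
  | insert a T ha ih =>
    rw [sum_insert ha]
    refine ((h a (mem_insert_self _ _)).induce_union
      (ih fun i hi => h i (mem_insert_of_mem hi))).induce_mono ?_
    rintro x ⟨i, hi, hx⟩
    rcases mem_insert.1 hi with rfl | hi
    · exact Or.inl hx
    · exact Or.inr ⟨i, hi, hx⟩

/-- In a disjoint union of cliques, injective labellings chosen on each clique separately fit
together to a proper colouring. -/
theorem IsP3FreeOn.exists_coloring [Finite V] {α : Type*} {X : Set V} (hX : G.IsP3FreeOn X)
    (P : V → α → Prop)
    (hP : ∀ K : Finset V, G.IsClique K → (K : Set V) ⊆ X →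
      ∃ f : V → α, (∀ x ∈ K, P x (f x)) ∧ Set.InjOn f K) :
    ∃ c : V → α, (∀ x ∈ X, P x (c x)) ∧ ∀ x ∈ X, ∀ y ∈ X, G.Adj x y → c x ≠ c y := by
  have := Fintype.ofFinite V
  let K : V → Finset V := fun x => {y | y ∈ X ∧ (y = x ∨ G.Adj x y)}
  have memK : ∀ x y, y ∈ K x ↔ y ∈ X ∧ (y = x ∨ G.Adj x y) := fun x y => by simp [K]
  have hK : ∀ x ∈ X, G.IsClique (K x) := by
    intro x hx y hy z hz hyz
    simp only [mem_coe, memK] at hy hz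
    rcases hy with ⟨hy, rfl | hxy⟩ <;> rcases hz with ⟨hz, rfl | hxz⟩
    · exact absurd rfl hyz
    · exact hxz
    · exact hxy.symm
    · exact hX hy hx hz hxy.symm hxz hyz
  have hKX : ∀ x, (K x : Set V) ⊆ X := fun x y hy => ((memK _ _).1 (mem_coe.1 hy)).1
  have hself : ∀ x ∈ X, x ∈ K x := fun x hx => (memK x x).2 ⟨hx, Or.inl rfl⟩
  have hsub : ∀ x ∈ X, ∀ y ∈ X, G.Adj x y → K y ⊆ K x := by
    intro x hx y hy hxy z hz
    rw [memK] at hz ⊢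
    rcases hz with ⟨hz, rfl | hyz⟩
    · exact ⟨hz, Or.inr hxy⟩
    · by_cases hzx : z = x
      · exact ⟨hz, Or.inl hzx⟩
      · exact ⟨hz, Or.inr (hX hx hy hz hxy hyz (Ne.symm hzx))⟩
  have hne : Nonempty (V → α) := (hP ∅ (by simp) (by simp)).nonempty
  choose! F hF hF' using hP
  refine ⟨fun x => F (K x) x, fun x hx => hF _ (hK x hx) (hKX x) x (hself x hx), ?_⟩
  intro x hx y hy hxy
  have e : K y = K x := (hsub x hx y hy hxy).antisymm (hsub y hy x hx hxy.symm)
  simp only [e]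
  exact fun h => hxy.ne (hF' _ (hK x hx) (hKX x) (hself x hx) (e ▸ hself y hy) h)

theorem IsP3FreeOn.colorable_induce [Finite V] {X : Set V} (hX : G.IsP3FreeOn X) {n : ℕ}
    (hn : ∀ K : Finset V, G.IsClique K → (K : Set V) ⊆ X → #K ≤ n) :
    (G.induce X).Colorable n := by
  obtain ⟨c, hc, hc'⟩ := hX.exists_coloring (α := ℕ) (fun _ i => i < n) (by
    intro K hK hKX
    refine ⟨fun x => if h : x ∈ K then K.equivFin ⟨x, h⟩ else 0, fun x hx => ?_, ?_⟩
    · simp only [hx, dite_true]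
      exact (K.equivFin ⟨x, hx⟩).2.trans_le (hn K hK hKX)
    · intro x hx y hy hxy
      have hx' : x ∈ K := hx
      have hy' : y ∈ K := hy
      simpa [hx', hy', Fin.val_inj] using hxy)
  simpa using colorable_induce_of_map (range n) c (by simpa using hc) hc'

/-- A maximum clique `A` together with a disjoint union of cliques `X` can be coloured with `#A`
colours: the complement of two cliques is bipartite, so Hall's theorem matches each clique of `X`
injectively into `A` along non-edges, and every vertex of `X` gets the colour of its partner. -/
theorem IsP3FreeOn.colorable_induce_union_maxClique [Finite V] {A : Finset V}
    (hA : G.IsClique A) (hmax : ∀ s : Finset V, G.IsClique s → #s ≤ #A) {X : Set V}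
    (hX : G.IsP3FreeOn X) (hXA : ∀ x ∈ X, x ∉ A) : (G.induce (↑A ∪ X)).Colorable #A := by
  obtain ⟨c, hc, hc'⟩ := hX.exists_coloring (α := V) (fun x a => a ∈ A ∧ ¬ G.Adj x a) (by
    intro K hK hKX
    have hall : ∀ s : Finset K, #s ≤ #(s.biUnion fun x => {a ∈ A | ¬ G.Adj (x : V) a}) := by
      intro s
      set N := s.biUnion fun x => {a ∈ A | ¬ G.Adj (x : V) a} with hN
      have hNA : N ⊆ A := by
        intro a ha
        simp only [hN, mem_biUnion, mem_filter] at ha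
        obtain ⟨_, _, ha, _⟩ := ha
        exact ha
      have hdisj : Disjoint (s.map (Function.Embedding.subtype _)) (A \ N) := by
        rw [Finset.disjoint_left]
        intro x hx hxA
        simp only [mem_map, Function.Embedding.subtype_apply] at hx
        obtain ⟨y, _, rfl⟩ := hx
        exact hXA _ (hKX y.2) (mem_sdiff.1 hxA).1
      have hmem : ∀ x ∈ s, ∀ a ∈ A \ N, G.Adj (x : V) a := by
        intro x hx a ha
        by_contra hcon
        refine (mem_sdiff.1 ha).2 ?_
        simp only [hN, mem_biUnion, mem_filter]
        exact ⟨x, hx, (mem_sdiff.1 ha).1, hcon⟩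
      have hcl : G.IsClique ((s.map (Function.Embedding.subtype _) ∪ (A \ N) : Finset V)) := by
        intro x hx y hy hxy
        simp only [coe_union, Set.mem_union, mem_coe, mem_map,
          Function.Embedding.subtype_apply] at hx hy
        rcases hx with ⟨x, hx, rfl⟩ | hx <;> rcases hy with ⟨y, hy, rfl⟩ | hy
        · exact hK x.2 y.2 hxy
        · exact hmem x hx y hy
        · exact (hmem y hy x hx).symm
        · exact hA (mem_sdiff.1 hx).1 (mem_sdiff.1 hy).1 hxy
      have h1 := hmax _ hcl
      rw [card_union_of_disjoint hdisj, card_map] at h1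
      have h2 := card_sdiff_add_card_eq_card hNA
      omega
    obtain ⟨f, hf, hf'⟩ := (all_card_le_biUnion_card_iff_exists_injective _).1 hall
    simp only [mem_filter] at hf'
    refine ⟨fun x => if h : x ∈ K then f ⟨x, h⟩ else x, fun x hx => ?_, ?_⟩
    · simp only [hx, dite_true]
      exact hf' ⟨x, hx⟩
    · intro x hx y hy hxy
      have hx' : x ∈ K := hx
      have hy' : y ∈ K := hy
      simpa [hx', hy', hf.eq_iff] using hxy)
  refine colorable_induce_of_map A (fun x => if x ∈ A then x else c x) ?_ ?_
  · rintro x (hx | hx)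
    · simp [mem_coe.1 hx]
    · simpa [hXA x hx] using (hc x hx).1
  · rintro x hx y hy hxy
    by_cases h1 : x ∈ A <;> by_cases h2 : y ∈ A
    · simpa [h1, h2] using hxy.ne
    · have hy := hy.resolve_left h2
      simp only [h1, h2, if_true, if_false]
      intro e
      exact (hc y hy).2 (e ▸ hxy.symm)
    · have hx := hx.resolve_left h1
      simp only [h1, h2, if_true, if_false]
      intro e
      exact (hc x hx).2 (e ▸ hxy)
    · simpa [h1, h2] using hc' x (hx.resolve_left h1) y (hy.resolve_left h2) hxy

/-! ### Neighbours in a maximum clique -/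

theorem exists_mem_not_adj_of_notMem {A : Finset V} (hA : G.IsClique A)
    (hmax : ∀ s : Finset V, G.IsClique s → #s ≤ #A) {x : V} (hx : x ∉ A) :
    ∃ a ∈ A, ¬ G.Adj x a := by
  by_contra! h
  have h1 := hmax (insert x A) (by
    rw [coe_insert]
    exact hA.insert fun b hb _ => h b hb)
  rw [card_insert_of_notMem hx] at h1
  omega

theorem IndFree.card_filter_adj_maxClique_lt {p : ℕ} (h : G.IndFree (twoK1JoinK p)) {A : Finset V}
    (hA : G.IsClique A) (hmax : ∀ s : Finset V, G.IsClique s → #s ≤ #A) {x : V} (hx : x ∉ A) :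
    #{a ∈ A | G.Adj x a} < p := by
  obtain ⟨a, ha, hxa⟩ := exists_mem_not_adj_of_notMem hA hmax hx
  exact h.card_filter_adj_lt hA ha (fun e => hx (e ▸ ha)) hxa

/-- A clique has at most one vertex without neighbours on a given induced path `x - y - z`. -/
theorem IndFree.false_of_path_clique (h : G.IndFree P3UnionP2) {x y z : V}
    (hxy : G.Adj x y) (hyz : G.Adj y z) (hne : x ≠ z) (hxz : ¬ G.Adj x z) {Q : Finset V}
    (hQ : G.IsClique Q) (h2 : 1 < #{a ∈ Q | ¬ G.Adj x a ∧ ¬ G.Adj y a ∧ ¬ G.Adj z a}) :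
    False := by
  obtain ⟨a, ha, b, hb, hab⟩ := one_lt_card.1 h2
  simp only [mem_filter] at ha hb
  exact h.false_of_path_edge hxy hyz hne hxz (hQ ha.1 hb.1 hab) ha.2.1 hb.2.1 ha.2.2.1 hb.2.2.1
    ha.2.2.2 hb.2.2.2

/-- If every vertex of `D` has so few neighbours in the clique `A` outside a fixed set `T` that
any three of them leave two vertices of `A` uncovered, then `D` induces no path on three
vertices. -/
theorem IndFree.isP3FreeOn_of_card_le (h : G.IndFree P3UnionP2) {A : Finset V}
    (hA : G.IsClique A) {D : Set V} (T : Finset V) {m : ℕ}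
    (hD : ∀ x ∈ D, #{a ∈ A \ T | G.Adj x a} ≤ m) (hm : #T + 3 * m + 2 ≤ #A) :
    G.IsP3FreeOn D := by
  intro x hx y hy z hz hxy hyz hne
  by_contra hxz
  refine h.false_of_path_clique hxy hyz hne hxz hA ?_
  have hcover : A ⊆ {a ∈ A | ¬ G.Adj x a ∧ ¬ G.Adj y a ∧ ¬ G.Adj z a} ∪
      (T ∪ ({a ∈ A \ T | G.Adj x a} ∪ ({a ∈ A \ T | G.Adj y a} ∪ {a ∈ A \ T | G.Adj z a}))) := by
    intro a ha
    simp only [mem_union, mem_filter, mem_sdiff]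
    tauto
  have h1 := card_le_card hcover
  have h2 := card_union_le {a ∈ A | ¬ G.Adj x a ∧ ¬ G.Adj y a ∧ ¬ G.Adj z a}
    (T ∪ ({a ∈ A \ T | G.Adj x a} ∪ ({a ∈ A \ T | G.Adj y a} ∪ {a ∈ A \ T | G.Adj z a})))
  have h3 := card_union_le T
    ({a ∈ A \ T | G.Adj x a} ∪ ({a ∈ A \ T | G.Adj y a} ∪ {a ∈ A \ T | G.Adj z a}))
  have h4 := card_union_le {a ∈ A \ T | G.Adj x a}
    ({a ∈ A \ T | G.Adj y a} ∪ {a ∈ A \ T | G.Adj z a})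
  have h5 := card_union_le {a ∈ A \ T | G.Adj y a} {a ∈ A \ T | G.Adj z a}
  have := hD x hx
  have := hD y hy
  have := hD z hz
  omega

/-! ### Cliques with at least `2 * p` vertices outside a maximum clique -/

/-- `Y` is the vertex set of a connected component of `G[B]` that is complete (or is empty). -/
structure IsCliqueComponent (G : SimpleGraph V) (B Y : Set V) : Prop where
  subset : Y ⊆ B
  isClique : G.IsClique Y
  mem_of_adj : ∀ y ∈ Y, ∀ z ∈ B, G.Adj y z → z ∈ Y

/-- The vertices lying in the complete connected components of `G[B]`. -/
def cliqueComponents (G : SimpleGraph V) (B : Set V) : Set V :=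
  {x | ∃ Y, G.IsCliqueComponent B Y ∧ x ∈ Y}

theorem IsP3FreeOn.union_cliqueComponents {B D : Set V} (hD : G.IsP3FreeOn D) (hDB : D ⊆ B) :
    G.IsP3FreeOn (D ∪ G.cliqueComponents B) := by
  have hsub : D ∪ G.cliqueComponents B ⊆ B :=
    Set.union_subset hDB fun x ⟨Y, hY, hx⟩ => hY.subset hx
  intro x hx y hy z hz hxy hyz hne
  by_cases hcomp : ∃ Y, G.IsCliqueComponent B Y ∧ (x ∈ Y ∨ y ∈ Y ∨ z ∈ Y)
  · obtain ⟨Y, hY, hmem⟩ := hcomp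
    have hyY : y ∈ Y := by
      rcases hmem with h | h | h
      · exact hY.mem_of_adj _ h _ (hsub hy) hxy
      · exact h
      · exact hY.mem_of_adj _ h _ (hsub hy) hyz.symm
    exact hY.isClique (hY.mem_of_adj _ hyY _ (hsub hx) hxy.symm)
      (hY.mem_of_adj _ hyY _ (hsub hz) hyz) hne
  · push Not at hcomp
    have hin : ∀ w ∈ D ∪ G.cliqueComponents B,
        (∀ Y, G.IsCliqueComponent B Y → w ∉ Y) → w ∈ D := by
      rintro w (hw | ⟨Y, hY, hw⟩) h
      · exact hw
      · exact absurd hw (h Y hY)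
    exact hD (hin x hx fun Y hY => (hcomp Y hY).1) (hin y hy fun Y hY => (hcomp Y hY).2.1)
      (hin z hz fun Y hY => (hcomp Y hY).2.2) hxy hyz hne

/-- Let `K` be a clique of at least `2 * p` vertices outside the maximum clique `A`, with no edges
to two vertices `a`, `b` of `A`. Then `K` together with all vertices outside `A` complete to it is
a component of `G - A`. Since a vertex not complete to `K` has fewer than `p` neighbours in it, `K`
has two vertices avoiding any two such vertices, which excludes the relevant induced paths. -/
theorem subset_cliqueComponents_of_two_mul_le {p : ℕ} (h32 : G.IndFree P3UnionP2)
    (hp : G.IndFree (twoK1JoinK p)) {A : Finset V} (hA : G.IsClique A)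
    (hmax : ∀ s : Finset V, G.IsClique s → #s ≤ #A) {K : Finset V} (hK : G.IsClique K)
    (hKA : ∀ x ∈ K, x ∉ A) {a b : V} (ha : a ∈ A) (hb : b ∈ A) (hab : a ≠ b)
    (hKa : ∀ x ∈ K, ¬ G.Adj a x) (hKb : ∀ x ∈ K, ¬ G.Adj b x) (hcard : 2 * p ≤ #K)
    (hp0 : 0 < p) : (K : Set V) ⊆ G.cliqueComponents {x | x ∉ A} := by
  set S : Finset V := {v ∈ A | ∀ x ∈ K, G.Adj v x} with hS
  have hSA : S ⊆ A := filter_subset _ _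
  have hAlt : ∀ x, x ∉ A → #{v ∈ A | G.Adj x v} < p := fun x hx =>
    hp.card_filter_adj_maxClique_lt hA hmax hx
  have hKlt : ∀ x, x ∉ K → (¬ ∀ y ∈ K, G.Adj x y) → #{y ∈ K | G.Adj x y} < p := by
    intro x hxK hx
    push Not at hx
    obtain ⟨y, hy, hxy⟩ := hx
    exact hp.card_filter_adj_lt hK hy (fun e => hxK (e ▸ hy)) hxy
  have hAK : ∀ v ∈ A, v ∉ K := fun v hv hvK => hKA v hvK hv
  have hSlt : ∀ v ∈ A \ S, #{y ∈ K | G.Adj v y} < p := by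
    intro v hv
    simp only [hS, mem_sdiff, mem_filter, not_and] at hv
    exact hKlt v (hAK v hv.1) (hv.2 hv.1)
  -- The clique `K ∪ S` is no larger than `A`.
  have hAS : 2 * p ≤ #(A \ S) := by
    have hdisj : Disjoint K S := by
      rw [Finset.disjoint_left]
      exact fun x hx hxS => hKA x hx (hSA hxS)
    have hcl : G.IsClique ((K ∪ S : Finset V)) := by
      have hSK : ∀ v ∈ S, ∀ x ∈ K, G.Adj v x := fun v hv => (mem_filter.1 hv).2
      intro x hx y hy hxy
      simp only [coe_union, Set.mem_union, mem_coe] at hx hy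
      rcases hx with hx | hx <;> rcases hy with hy | hy
      · exact hK hx hy hxy
      · exact (hSK y hy x hx).symm
      · exact hSK x hx y hy
      · exact hA (hSA hx) (hSA hy) hxy
    have h1 := hmax _ hcl
    rw [card_union_of_disjoint hdisj] at h1
    have h2 := card_sdiff_add_card_eq_card hSA
    omega
  -- Two vertices with few neighbours in `K` miss two common vertices of `K`.
  have hpair : ∀ x y z, #{w ∈ K | G.Adj x w} < p → #{w ∈ K | G.Adj y w} < p →
      (∀ w ∈ K, ¬ G.Adj z w) →
      1 < #{w ∈ K | ¬ G.Adj x w ∧ ¬ G.Adj y w ∧ ¬ G.Adj z w} := by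
    intro x y z hx hy hz
    have hcover : K ⊆ {w ∈ K | ¬ G.Adj x w ∧ ¬ G.Adj y w ∧ ¬ G.Adj z w} ∪
        ({w ∈ K | G.Adj x w} ∪ {w ∈ K | G.Adj y w}) := by
      intro w hw
      have := hz w hw
      simp only [mem_union, mem_filter]
      tauto
    have h1 := card_le_card hcover
    have h2 := card_union_le {w ∈ K | ¬ G.Adj x w ∧ ¬ G.Adj y w ∧ ¬ G.Adj z w}
      ({w ∈ K | G.Adj x w} ∪ {w ∈ K | G.Adj y w})
    have h3 := card_union_le {w ∈ K | G.Adj x w} {w ∈ K | G.Adj y w}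
    omega
  have hmiss : ∀ z, z ∉ A → ∃ t ∈ A \ S, ¬ G.Adj z t := by
    intro z hz
    by_contra! hcon
    have h1 : A \ S ⊆ ({v ∈ A | G.Adj z v} : Finset V) := fun t ht =>
      mem_filter.2 ⟨(mem_sdiff.1 ht).1, hcon t ht⟩
    have h2 := card_le_card h1
    have h3 := hAlt z hz
    omega
  -- A vertex outside `A` not complete to `K` cannot be adjacent to `v ∈ A \ S`
  -- if it or `v` has no neighbours in `K`.
  have hkey : ∀ z, z ∉ A → z ∉ K → (¬ ∀ y ∈ K, G.Adj z y) → ∀ v ∈ A \ S, G.Adj z v →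
      ((∀ w ∈ K, ¬ G.Adj z w) ∨ ∀ w ∈ K, ¬ G.Adj v w) → False := by
    intro z hzA hzK hz v hv hzv hor
    obtain ⟨t, ht, hzt⟩ := hmiss z hzA
    have hvA := (mem_sdiff.1 hv).1
    have htA := (mem_sdiff.1 ht).1
    have hvt : G.Adj v t := hA hvA htA (by rintro rfl; exact hzt hzv)
    refine h32.false_of_path_clique hzv hvt (fun e => hzA (e ▸ htA)) hzt hK ?_
    rcases hor with h | h
    · refine (hpair v t z (hSlt v hv) (hSlt t ht) h).trans_le
        (card_le_card fun w hw => ?_)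
      simp only [mem_filter] at hw ⊢
      tauto
    · refine (hpair z t v (hKlt z hzK hz) (hSlt t ht) h).trans_le
        (card_le_card fun w hw => ?_)
      simp only [mem_filter] at hw ⊢
      tauto
  have hne : ∃ x, x ∈ K := by
    by_contra! hcon
    rw [eq_empty_of_forall_notMem hcon, card_empty] at hcard
    omega
  have hnS : ∀ v ∈ A, (∀ x ∈ K, ¬ G.Adj v x) → v ∈ A \ S := by
    intro v hv hvK
    obtain ⟨x, hx⟩ := hne
    exact mem_sdiff.2 ⟨hv, fun hvS => hvK x hx ((mem_filter.1 hvS).2 x hx)⟩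
  have hpartial : ∀ z, z ∉ A → z ∉ K → (¬ ∀ y ∈ K, G.Adj z y) → ∀ y ∈ K, ¬ G.Adj z y := by
    intro z hzA hzK hz y hy hzy
    have hza : ¬ G.Adj z a := fun h => hkey z hzA hzK hz a (hnS a ha hKa) h (Or.inr hKa)
    have hzb : ¬ G.Adj z b := fun h => hkey z hzA hzK hz b (hnS b hb hKb) h (Or.inr hKb)
    push Not at hz
    obtain ⟨x, hx, hzx⟩ := hz
    have hyx : G.Adj y x := hK hy hx (by rintro rfl; exact hzx hzy)
    exact h32.false_of_path_edge hzy hyx (fun e => hzK (e ▸ hx)) hzx (hA ha hb hab) hza hzb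
      (fun h => hKa y hy h.symm) (fun h => hKb y hy h.symm) (fun h => hKa x hx h.symm)
      (fun h => hKb x hx h.symm)
  refine fun x hx => ⟨{y | y ∉ A ∧ (y ∈ K ∨ ∀ w ∈ K, G.Adj y w)}, ⟨fun y hy => hy.1, ?_, ?_⟩,
    hKA x hx, Or.inl hx⟩
  · rintro y ⟨-, hy⟩ z ⟨-, hz⟩ hyz
    rcases hy with hy | hy <;> rcases hz with hz | hz
    · exact hK hy hz hyz
    · exact (hz y hy).symm
    · exact hy z hz
    · by_contra hcon
      exact hp.false_of_common_clique hyz hcon hK (by omega) hy hz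
  · rintro y ⟨hyA, hy⟩ z hzA hyz
    refine ⟨hzA, ?_⟩
    by_contra! hcon
    obtain ⟨hzK, w, hw, hzw⟩ := hcon
    have hz : ¬ ∀ y ∈ K, G.Adj z y := fun h => hzw (h w hw)
    have hz0 := hpartial z hzA hzK hz
    have hyK : y ∉ K := fun hyK => hz0 y hyK hyz.symm
    have hyw : G.Adj w y := (hy.resolve_left hyK w hw).symm
    refine h32.false_of_path_clique hyw hyz (fun e => hzK (e ▸ hw)) (fun h => hzw h.symm) hA ?_
    have hcover : A \ S ⊆ {v ∈ A | ¬ G.Adj w v ∧ ¬ G.Adj y v ∧ ¬ G.Adj z v} ∪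
        ({v ∈ A | G.Adj w v} ∪ {v ∈ A | G.Adj y v}) := by
      intro v hv
      have hvA := (mem_sdiff.1 hv).1
      have hzv : ¬ G.Adj z v := fun h => hkey z hzA hzK hz v hv h (Or.inl hz0)
      simp only [mem_union, mem_filter]
      tauto
    have h1 := card_le_card hcover
    have h2 := card_union_le {v ∈ A | ¬ G.Adj w v ∧ ¬ G.Adj y v ∧ ¬ G.Adj z v}
      ({v ∈ A | G.Adj w v} ∪ {v ∈ A | G.Adj y v})
    have h3 := card_union_le {v ∈ A | G.Adj w v} {v ∈ A | G.Adj y v}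
    have h4 := hAlt w (hKA w hw)
    have h5 := hAlt y hyA
    omega

/-! ### Classes given by the first two non-neighbours along an ordered clique -/

/-- The vertices whose first two non-neighbours in the sequence `v` are `v i` and `v j`, where
`i < j` is intended. -/
def missClass (G : SimpleGraph V) (v : ℕ → V) (i j : ℕ) : Set V :=
  {x | ¬ G.Adj x (v i) ∧ ¬ G.Adj x (v j) ∧ ∀ l < j, l ≠ i → G.Adj x (v l)}

theorem isP3FreeOn_missClass (h : G.IndFree P3UnionP2) {v : ℕ → V} {i j : ℕ}
    (hij : G.Adj (v i) (v j)) : G.IsP3FreeOn (G.missClass v i j) := by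
  intro x hx y hy z hz hxy hyz hne
  by_contra hxz
  exact h.false_of_path_edge hxy hyz hne hxz hij hx.1 hx.2.1 hy.1 hy.2.1 hz.1 hz.2.1

theorem exists_mem_missClass (v : ℕ → V) (x : V) (n : ℕ)
    (h : 1 < #{l ∈ range n | ¬ G.Adj x (v l)}) :
    ∃ j < n, ∃ i < j, x ∈ G.missClass v i j := by
  induction n with
  | zero => simp at h
  | succ n ih =>
    by_cases h1 : 1 < #{l ∈ range n | ¬ G.Adj x (v l)}
    · obtain ⟨j, hj, hx⟩ := ih h1
      exact ⟨j, by omega, hx⟩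
    · rw [range_add_one, filter_insert] at h
      by_cases hn : G.Adj x (v n)
      · simp only [hn, not_true_eq_false, if_false] at h
        exact absurd h h1
      · simp only [hn, not_false_eq_true, if_true] at h
        have h2 := card_insert_le n {l ∈ range n | ¬ G.Adj x (v l)}
        obtain ⟨i, hi⟩ := card_eq_one.1 (by omega : #{l ∈ range n | ¬ G.Adj x (v l)} = 1)
        have hmem : ∀ l, (l < n ∧ ¬ G.Adj x (v l)) ↔ l = i := by
          intro l
          have := congrArg (fun s => l ∈ s) hi
          simpa using this
        obtain ⟨hin, hxi⟩ := (hmem i).2 rfl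
        refine ⟨n, by omega, i, hin, hxi, hn, fun l hl hli => ?_⟩
        by_contra hcon
        exact hli ((hmem l).1 ⟨hl, hcon⟩)

/-- A clique in `missClass v i j` extends by the `j - 1` common neighbours `v l` with `l < j`,
`l ≠ i`. -/
theorem isClique_union_prefix {v : ℕ → V} {i j : ℕ} (hij : i < j)
    (hv : ∀ a ≤ j, ∀ b ≤ j, a ≠ b → G.Adj (v a) (v b)) {K : Finset V} (hK : G.IsClique K)
    (hKs : (K : Set V) ⊆ G.missClass v i j) :
    G.IsClique (K ∪ ((range j).erase i).image v : Finset V) ∧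
      #(K ∪ ((range j).erase i).image v) = #K + (j - 1) := by
  have hH : ∀ y ∈ ((range j).erase i).image v, ∃ l < j, l ≠ i ∧ v l = y := by
    intro y hy
    obtain ⟨l, hl, rfl⟩ := mem_image.1 hy
    exact ⟨l, by simpa using (mem_erase.1 hl).2, (mem_erase.1 hl).1, rfl⟩
  constructor
  · intro x hx y hy hxy
    simp only [coe_union, Set.mem_union, mem_coe] at hx hy
    rcases hx with hx | hx <;> rcases hy with hy | hy
    · exact hK hx hy hxy
    · obtain ⟨l, hl, hli, rfl⟩ := hH y hy
      exact (hKs hx).2.2 l hl hli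
    · obtain ⟨l, hl, hli, rfl⟩ := hH x hx
      exact ((hKs hy).2.2 l hl hli).symm
    · obtain ⟨l, hl, hli, rfl⟩ := hH x hx
      obtain ⟨m, hm, hmi, rfl⟩ := hH y hy
      exact hv l hl.le m hm.le (by rintro rfl; exact hxy rfl)
  · rw [card_union_of_disjoint, card_image_of_injOn, card_erase_of_mem (by simpa using hij),
      card_range]
    · intro a ha b hb hab
      by_contra hne
      have ha' : a < j := by simpa using (mem_erase.1 ha).2
      have hb' : b < j := by simpa using (mem_erase.1 hb).2
      exact (hv a ha'.le b hb'.le hne).ne hab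
    · rw [Finset.disjoint_left]
      intro x hx hxH
      obtain ⟨l, hl, hli, rfl⟩ := hH x hxH
      exact (hKs hx).2.1 (hv l hl.le j le_rfl hl.ne)

/-- A clique in `missClass v i j` which, together with the prefix, has at least `p + 2` vertices
excludes every vertex with the same second non-neighbour `v j` but another first non-neighbour
`v i'`. -/
theorem missClass_eq_empty_of_large_clique {p : ℕ} (h32 : G.IndFree P3UnionP2)
    (hp : G.IndFree (twoK1JoinK p)) {v : ℕ → V} {i i' j : ℕ} (hij : i < j) (hij' : i' < j)
    (hne : i' ≠ i) (hv : ∀ a ≤ j, ∀ b ≤ j, a ≠ b → G.Adj (v a) (v b)) {K : Finset V}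
    (hK : G.IsClique K) (hKs : (K : Set V) ⊆ G.missClass v i j)
    (hcard : p + 2 ≤ #K + (j - 1)) : G.missClass v i' j = ∅ := by
  rw [Set.eq_empty_iff_forall_notMem]
  intro z hz
  obtain ⟨hQ, hQc⟩ := isClique_union_prefix hij hv hK hKs
  set H := ((range j).erase i).image v with hH
  have hi'j := hv i' hij'.le j le_rfl hij'.ne
  have hzne : z ≠ v i' := by
    rintro rfl
    exact hz.2.1 hi'j
  have hlt := hp.card_filter_adj_lt hQ (z := z) (q := v i')
    (mem_union_right _ (mem_image_of_mem _ (by simp [hij', hne]))) hzne hz.1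
  have hsplit := card_filter_add_card_filter_not (s := K ∪ H) (fun x => G.Adj z x)
  -- `v i'` is the only non-neighbour of `z` in the prefix, so `z` misses two vertices of `K`.
  have hsub : ({x ∈ K ∪ H | ¬ G.Adj z x} : Finset V) ⊆ insert (v i') {x ∈ K | ¬ G.Adj z x} := by
    intro x hx
    obtain ⟨hx, hzx⟩ := mem_filter.1 hx
    rcases mem_union.1 hx with hx | hx
    · exact mem_insert_of_mem (mem_filter.2 ⟨hx, hzx⟩)
    · obtain ⟨l, hl, rfl⟩ := mem_image.1 hx
      have hlj : l < j := by simpa using (mem_erase.1 hl).2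
      by_cases hl' : l = i'
      · subst hl'
        exact mem_insert_self _ _
      · exact absurd (hz.2.2 l hlj hl') hzx
  have h1 := card_le_card hsub
  have h2 := card_insert_le (v i') {x ∈ K | ¬ G.Adj z x}
  refine h32.false_of_path_clique (hz.2.2 i hij hne.symm) (hv i hij.le j le_rfl hij.ne)
    (by rintro rfl; exact hz.1 hi'j.symm) hz.2.1 hK ?_
  have h3 : ({x ∈ K | ¬ G.Adj z x} : Finset V) ⊆
      {x ∈ K | ¬ G.Adj z x ∧ ¬ G.Adj (v i) x ∧ ¬ G.Adj (v j) x} := by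
    intro x hx
    obtain ⟨hx, hzx⟩ := mem_filter.1 hx
    exact mem_filter.2 ⟨hx, hzx, fun h => (hKs hx).1 h.symm, fun h => (hKs hx).2.1 h.symm⟩
  have h4 := card_le_card h3
  omega

theorem colorable_induce_secondMiss_of_card_le [Finite V] (h32 : G.IndFree P3UnionP2) {v : ℕ → V}
    {j n : ℕ} (hv : ∀ a ≤ j, ∀ b ≤ j, a ≠ b → G.Adj (v a) (v b)) (Z : Set V)
    (hn : ∀ i < j, ∀ K : Finset V, G.IsClique K → (K : Set V) ⊆ G.missClass v i j \ Z →
      #K ≤ n) :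
    (G.induce {x | ∃ i ∈ range j, x ∈ G.missClass v i j \ Z}).Colorable (j * n) := by
  have h := Colorable.induce_biUnion (G := G) (range j) (fun i => G.missClass v i j \ Z)
    (fun _ => n) (by
      intro i hi
      have hij : i < j := by simpa using hi
      exact ((isP3FreeOn_missClass h32 (hv i hij.le j le_rfl hij.ne)).mono
        Set.sdiff_subset).colorable_induce (hn i hij))
  simpa using h

/-- The vertices with second non-neighbour `v j` need at most `j * (p + 2 - j)` colours: either
all classes have small cliques, or only one class is non-empty. -/
theorem colorable_induce_secondMiss [Finite V] {p : ℕ} (h32 : G.IndFree P3UnionP2)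
    (hp : G.IndFree (twoK1JoinK p)) {v : ℕ → V} {j : ℕ} (hj : 2 ≤ j) (hjp : j + 1 ≤ p)
    (hv : ∀ a ≤ j, ∀ b ≤ j, a ≠ b → G.Adj (v a) (v b)) (Z : Set V)
    (hn : ∀ i < j, ∀ K : Finset V, G.IsClique K → (K : Set V) ⊆ G.missClass v i j \ Z →
      #K ≤ 2 * p - 1) :
    (G.induce {x | ∃ i ∈ range j, x ∈ G.missClass v i j \ Z}).Colorable (j * (p + 2 - j)) := by
  by_cases hbig : ∃ i < j, ∃ K : Finset V, G.IsClique K ∧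
      (K : Set V) ⊆ G.missClass v i j \ Z ∧ p + 2 ≤ #K + (j - 1)
  · obtain ⟨i, hij, K, hK, hKs, hcard⟩ := hbig
    have hcol := ((isP3FreeOn_missClass h32 (hv i hij.le j le_rfl hij.ne)).mono
      (Set.sdiff_subset (t := Z))).colorable_induce (hn i hij)
    refine (hcol.induce_mono ?_).mono ?_
    · rintro x ⟨i', hi', hx⟩
      by_cases hne : i' = i
      · exact hne ▸ hx
      · have := missClass_eq_empty_of_large_clique h32 hp hij (by simpa using hi') hne hv hK
          (hKs.trans Set.sdiff_subset) hcard
        rw [this] at hx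
        exact absurd hx.1 (Set.notMem_empty x)
    · obtain ⟨c, rfl⟩ := Nat.exists_eq_add_of_le hj
      obtain ⟨d, rfl⟩ := Nat.exists_eq_add_of_le hjp
      have e : 2 + c + 1 + d + 2 - (2 + c) = 3 + d := by omega
      have e' : 2 * (2 + c + 1 + d) - 1 = 2 * c + 2 * d + 5 := by omega
      rw [e, e']
      nlinarith [Nat.zero_le (c * d)]
  · push Not at hbig
    refine colorable_induce_secondMiss_of_card_le h32 hv Z fun i hi K hK hKs => ?_
    have := hbig i hi K hK hKs
    omega

theorem exists_enumeration {A : Finset V} (hA : G.IsClique A) (hne : A.Nonempty) :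
    ∃ v : ℕ → V, (∀ i < #A, v i ∈ A) ∧ (∀ a ∈ A, ∃ i < #A, v i = a) ∧
      ∀ i < #A, ∀ j < #A, i ≠ j → G.Adj (v i) (v j) := by
  obtain ⟨a₀, -⟩ := hne
  have hval : ∀ i (h : i < #A), (if h : i < #A then (A.equivFin.symm ⟨i, h⟩ : V) else a₀) =
      A.equivFin.symm ⟨i, h⟩ := fun i h => by simp [h]
  refine ⟨fun i => if h : i < #A then (A.equivFin.symm ⟨i, h⟩ : V) else a₀, ?_, ?_, ?_⟩
  · intro i hi
    simp only [hval i hi]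
    exact (A.equivFin.symm ⟨i, hi⟩).2
  · intro a ha
    refine ⟨A.equivFin ⟨a, ha⟩, (A.equivFin ⟨a, ha⟩).2, ?_⟩
    simp
  · intro i hi j hj hij
    simp only [hval i hi, hval j hj]
    refine hA (A.equivFin.symm ⟨i, hi⟩).2 (A.equivFin.symm ⟨j, hj⟩).2 fun e => hij ?_
    simpa using Subtype.ext e

/-! ### The bounds -/

/-- If `2 ≤ M ≤ p` and the maximum clique has at least `3 * p - 2 * M + 2` vertices, the vertices
with at most one non-neighbour among `v 0, …, v (M - 1)` induce no path on three vertices and share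
the colours of the clique; the others are coloured by their second non-neighbour. -/
theorem colorable_of_le_card_maxClique [Finite V] {p M : ℕ} (h32 : G.IndFree P3UnionP2)
    (hp : G.IndFree (twoK1JoinK p)) {A : Finset V} (hA : G.IsClique A)
    (hmax : ∀ s : Finset V, G.IsClique s → #s ≤ #A) (hM : 2 ≤ M) (hMp : M ≤ p)
    (hcard : M + 3 * (p - M) + 2 ≤ #A) :
    G.Colorable (#A + (2 * p - 1) + ∑ j ∈ Icc 3 M, (j - 1) * (p + 3 - j)) := by
  obtain ⟨v, hvA, -, hv⟩ := exists_enumeration hA (card_pos.1 (by omega))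
  have hv' : ∀ j < M, ∀ a ≤ j, ∀ b ≤ j, a ≠ b → G.Adj (v a) (v b) := fun j hj a ha b hb =>
    hv a (by omega) b (by omega)
  set B : Set V := {x | x ∉ A} with hB
  set Z := G.cliqueComponents B with hZ
  set T := (range M).image v with hT
  have hvinj : Set.InjOn v (range M) := by
    intro a ha b hb hab
    simp only [coe_range, Set.mem_Iio] at ha hb
    by_contra hne
    exact (hv a (by omega) b (by omega) hne).ne hab
  have hTA : T ⊆ A := by
    intro x hx
    obtain ⟨l, hl, rfl⟩ := mem_image.1 hx
    exact hvA l (by have := mem_range.1 hl; omega)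
  set D : Set V := {x | x ∉ A ∧ #{l ∈ range M | ¬ G.Adj x (v l)} ≤ 1} with hD
  have hDfree : G.IsP3FreeOn D := by
    refine h32.isP3FreeOn_of_card_le hA T (m := p - M) ?_ ?_
    · rintro x ⟨hxA, hx⟩
      have h1 := hp.card_filter_adj_maxClique_lt hA hmax hxA
      have h2 := card_filter_add_card_filter_not (s := range M) (fun l => G.Adj x (v l))
      rw [card_range] at h2
      have h3 : #{a ∈ T | G.Adj x a} = #{l ∈ range M | G.Adj x (v l)} := by
        rw [hT, filter_image, card_image_of_injOn (hvinj.mono (filter_subset _ _))]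
      have h4 : ({a ∈ A | G.Adj x a} : Finset V) =
          {a ∈ A \ T | G.Adj x a} ∪ {a ∈ T | G.Adj x a} := by
        rw [← filter_union, sdiff_union_of_subset hTA]
      have h5 : Disjoint ({a ∈ A \ T | G.Adj x a} : Finset V) {a ∈ T | G.Adj x a} :=
        disjoint_filter_filter sdiff_disjoint
      rw [h4, card_union_of_disjoint h5] at h1
      omega
    · rw [hT, card_image_of_injOn hvinj, card_range]
      omega
  have hDZ := hDfree.union_cliqueComponents (B := B) fun x hx => hx.1
  have hZB : ∀ x ∈ Z, x ∉ A := fun x ⟨Y, hY, hx⟩ => hY.subset hx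
  have c1 := hDZ.colorable_induce_union_maxClique hA hmax (by
    rintro x (hx | hx)
    · exact hx.1
    · exact hZB x hx)
  -- Outside the complete components of `G - A`, cliques in the classes have less than `2 * p`
  -- vertices.
  have hsmall : ∀ j < M, ∀ i < j, ∀ K : Finset V, G.IsClique K →
      (K : Set V) ⊆ G.missClass v i j \ (A ∪ Z) → #K ≤ 2 * p - 1 := by
    intro j hj i hi K hK hKs
    by_contra! hlt
    have hKZ := subset_cliqueComponents_of_two_mul_le h32 hp hA hmax hK
      (fun x hx hxA => (hKs hx).2 (Or.inl hxA)) (hvA i (by omega)) (hvA j (by omega))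
      (hv i (by omega) j (by omega) hi.ne).ne (fun x hx h => (hKs hx).1.1 h.symm)
      (fun x hx h => (hKs hx).1.2.1 h.symm) (by omega) (by omega)
    obtain ⟨x, hx⟩ := card_pos.1 (by omega : 0 < #K)
    exact (hKs hx).2 (Or.inr (hKZ hx))
  have c2 := colorable_induce_secondMiss_of_card_le h32 (hv' 1 (by omega)) (A ∪ Z)
    (hsmall 1 (by omega))
  have c3 := Colorable.induce_biUnion (G := G) (Icc 3 M)
    (fun j => {x | ∃ i ∈ range (j - 1), x ∈ G.missClass v i (j - 1) \ (A ∪ Z)})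
    (fun j => (j - 1) * (p + 3 - j)) (by
      intro j hj
      obtain ⟨hj1, hj2⟩ := mem_Icc.1 hj
      have := colorable_induce_secondMiss h32 hp (by omega : 2 ≤ j - 1) (by omega)
        (hv' (j - 1) (by omega)) (A ∪ Z) (hsmall (j - 1) (by omega))
      rwa [show p + 2 - (j - 1) = p + 3 - j by omega] at this)
  rw [one_mul] at c2
  refine ((c1.induce_union c2).induce_union c3).of_induce fun x => ?_
  by_cases hx : x ∈ (A : Set V) ∪ Z
  · exact Or.inl (Or.inl (hx.imp_right Or.inr))
  by_cases hxD : x ∈ D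
  · exact Or.inl (Or.inl (Or.inr (Or.inl hxD)))
  obtain ⟨j, hj, i, hi, hxij⟩ := exists_mem_missClass (G := G) v x M (by
    by_contra! hcon
    exact hxD ⟨fun h => hx (Or.inl h), hcon⟩)
  by_cases hj1 : j = 1
  · subst hj1
    exact Or.inl (Or.inr ⟨i, by simpa using hi, hxij, hx⟩)
  · exact Or.inr ⟨j + 1, by simp; omega, i, by simpa using hi, hxij, hx⟩

/-- If the maximum clique has at most `p + 1` vertices, the vertices with exactly one non-neighbour
in it take the colour of that non-neighbour, and the others are coloured by their first two
non-neighbours. -/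
theorem colorable_of_card_maxClique_le [Finite V] {p : ℕ} (h32 : G.IndFree P3UnionP2)
    {A : Finset V} (hA : G.IsClique A) (hmax : ∀ s : Finset V, G.IsClique s → #s ≤ #A)
    (hne : A.Nonempty) (hcard : #A ≤ p + 1) :
    G.Colorable (#A + ∑ j ∈ Icc 2 (p + 1), (j - 1) * (p + 3 - j)) := by
  obtain ⟨v, hvA, hAv, hv⟩ := exists_enumeration hA hne
  -- A vertex of `A` lies in `D`: its only non-neighbour in `A` is the vertex itself.
  set D : Set V := {x | #{l ∈ range #A | ¬ G.Adj x (v l)} ≤ 1} with hD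
  have hmiss : ∀ x, ∃ a ∈ A, ¬ G.Adj x a := by
    intro x
    by_cases hx : x ∈ A
    · exact ⟨x, hx, G.irrefl⟩
    · exact exists_mem_not_adj_of_notMem hA hmax hx
  choose c hcA hc using hmiss
  have hcu : ∀ x ∈ D, ∀ a ∈ A, ¬ G.Adj x a → a = c x := by
    intro x hx a ha hxa
    obtain ⟨i, hi, rfl⟩ := hAv a ha
    obtain ⟨j, hj, hjc⟩ := hAv (c x) (hcA x)
    rw [← hjc]
    refine congrArg v (card_le_one.1 hx i ?_ j ?_)
    · simpa [hi] using hxa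
    · simpa [hj, hjc] using hc x
  have c1 : (G.induce D).Colorable #A := by
    refine colorable_induce_of_map A c (fun x _ => hcA x) ?_
    intro x hx y hy hxy hcxy
    have hxc : x ∉ A.erase (c x) := by
      intro h
      exact (mem_erase.1 h).1 (hcu x hx x (mem_erase.1 h).2 G.irrefl)
    have hyc : y ∉ A.erase (c x) := by
      intro h
      exact (mem_erase.1 h).1 ((hcu y hy y (mem_erase.1 h).2 G.irrefl).trans hcxy.symm)
    have hadj : ∀ z ∈ D, c z = c x → ∀ a ∈ A.erase (c x), G.Adj z a := by
      intro z hz hzc a ha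
      by_contra hcon
      exact (mem_erase.1 ha).1 ((hcu z hz a (mem_erase.1 ha).2 hcon).trans hzc)
    have h1 := hmax (insert x (insert y (A.erase (c x)))) (by
      rw [coe_insert, coe_insert]
      refine ((hA.subset (by simp)).insert fun b hb _ => hadj y hy hcxy.symm b hb).insert ?_
      rintro b (rfl | hb) _
      · exact hxy
      · exact hadj x hx rfl b hb)
    rw [card_insert_of_notMem (by simp only [mem_insert, not_or]; exact ⟨hxy.ne, hxc⟩),
      card_insert_of_notMem hyc, card_erase_of_mem (hcA x)] at h1
    have := card_pos.2 hne
    omega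
  have c2 := Colorable.induce_biUnion (G := G) (Icc 2 #A)
    (fun j => {x | ∃ i ∈ range (j - 1), x ∈ G.missClass v i (j - 1) \ ∅})
    (fun j => (j - 1) * (p + 3 - j)) (by
      intro j hj
      obtain ⟨hj1, hj2⟩ := mem_Icc.1 hj
      have hvj : ∀ a ≤ j - 1, ∀ b ≤ j - 1, a ≠ b → G.Adj (v a) (v b) := fun a ha b hb =>
        hv a (by omega) b (by omega)
      refine colorable_induce_secondMiss_of_card_le h32 hvj ∅ fun i hi K hK hKs => ?_
      obtain ⟨hQ, hQc⟩ := isClique_union_prefix hi hvj hK (hKs.trans Set.sdiff_subset)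
      have := hmax _ hQ
      omega)
  have hsum : ∑ j ∈ Icc 2 #A, (j - 1) * (p + 3 - j) ≤
      ∑ j ∈ Icc 2 (p + 1), (j - 1) * (p + 3 - j) :=
    sum_le_sum_of_subset (Icc_subset_Icc_right hcard)
  refine ((c1.induce_union c2).of_induce fun x => ?_).mono (by omega)
  by_cases hx : x ∈ D
  · exact Or.inl hx
  · obtain ⟨j, hj, i, hi, hxij⟩ := exists_mem_missClass (G := G) v x #A (by
      by_contra! hcon
      exact hx hcon)
    exact Or.inr ⟨j + 1, by simp; omega, i, by simpa using hi, hxij, Set.notMem_empty x⟩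

/-- If the maximum clique `A` has at least `3 * p - 1` vertices, then `G - A` has no induced path
on three vertices. -/
theorem colorable_card_maxClique [Finite V] {p : ℕ} (h32 : G.IndFree P3UnionP2)
    (hp : G.IndFree (twoK1JoinK p)) {A : Finset V} (hA : G.IsClique A)
    (hmax : ∀ s : Finset V, G.IsClique s → #s ≤ #A) (hp0 : 0 < p) (hcard : 3 * p - 1 ≤ #A) :
    G.Colorable #A := by
  have hfree : G.IsP3FreeOn {x | x ∉ A} := by
    refine h32.isP3FreeOn_of_card_le hA ∅ (m := p - 1) ?_ (by simp; omega)
    intro x hx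
    have := hp.card_filter_adj_maxClique_lt hA hmax hx
    rw [sdiff_empty]
    omega
  refine (hfree.colorable_induce_union_maxClique hA hmax fun x hx => hx).of_induce fun x => ?_
  exact (em (x ∈ A)).imp id id

end

end SimpleGraph

theorem corollary4p3 {V : Type*} [Finite V] (G : SimpleGraph V) (p : ℕ) (hp : 2 ≤ p)
    (h32 : G.IndFree SimpleGraph.P3UnionP2) (hK : G.IndFree (SimpleGraph.twoK1JoinK p)) :
    (3 ≤ G.cliqueNum → G.cliqueNum ≤ p + 1 →
      G.chromaticNumber ≤
        ((G.cliqueNum + ∑ j ∈ Finset.Icc 2 (p + 1), (j - 1) * (p + 3 - j) : ℕ) : ℕ∞)) ∧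
    (∀ k : ℕ, k + 5 ≤ 2 * p → G.cliqueNum = p + 2 + k →
      G.chromaticNumber ≤
        ((G.cliqueNum + (2 * p - 1) +
          ∑ j ∈ Finset.Icc 3 (p - k / 2), (j - 1) * (p + 3 - j) : ℕ) : ℕ∞)) ∧
    (G.cliqueNum = 3 * p - 2 →
      G.chromaticNumber ≤ ((G.cliqueNum + (2 * p - 1) : ℕ) : ℕ∞)) ∧
    (3 * p - 1 ≤ G.cliqueNum →
      G.chromaticNumber = (G.cliqueNum : ℕ∞)) := by
  obtain ⟨A, hA, hAc⟩ := G.exists_isNClique_cliqueNum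
  have hmax : ∀ s : Finset V, G.IsClique s → s.card ≤ A.card := fun s hs =>
    hAc ▸ hs.card_le_cliqueNum
  rw [← hAc]
  refine ⟨fun h3 hle => ?_, fun k hk hω => ?_, fun hω => ?_, fun hω => le_antisymm ?_ ?_⟩
  · exact (SimpleGraph.colorable_of_card_maxClique_le h32 hA hmax
      (Finset.card_pos.1 (by omega)) hle).chromaticNumber_le
  · exact (SimpleGraph.colorable_of_le_card_maxClique h32 hK hA hmax (by omega) (by omega)
      (by omega)).chromaticNumber_le
  · have h := SimpleGraph.colorable_of_le_card_maxClique (M := 2) h32 hK hA hmax le_rfl hp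
      (by omega)
    rw [Finset.Icc_eq_empty (by omega), Finset.sum_empty, add_zero] at h
    exact h.chromaticNumber_le
  · exact (SimpleGraph.colorable_card_maxClique h32 hK hA hmax (by omega) hω).chromaticNumber_le
  · rw [hAc]
    exact G.cliqueNum_le_chromaticNumber
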